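/- A decreasing plane 1-2 tree on $[n]=\{1,\dots,n\}$ is a rooted tree with $n$ vertices in which every non-leaf vertex has one child or two linearly ordered children, and whose vertices are bijectively labeled by $[n]$ so that the label of each non-root vertex is less than the label of its parent. The subtree of a vertex $v$ consists of $v$ and all its descendants, and its size is its number of vertices. The rank of $v$ is the number of edges in the shortest path from $v$ to a leaf that is a descendant of $v$ (so leaves have rank $0$). For $n\ge 1$, choose a vertex uniformly at random among all vertices of all decreasing plane 1-2 trees on $[n]$. For $k\ge 0$ and $i\ge 1$, let $a_{n,k}$ be the probability that the chosen vertex has rank $k$, and let $W_{n,k,i}$ be the probability that it has rank $k$ and its subtree has size exactly $i$. Theorem. For every integer $k\ge 0$: (1) for every $i\ge 1$ the limit $w_{k,i}=\lim_{n\to\infty}W_{n,k,i}$ exists; (2) the series $\sum_{i\ge 1}w_{k,i}$ converges; (3) the limit $a_k=\lim_{n\to\infty}a_{n,k}$ exists, and $$a_k=\sum_{i=1}^{\infty}w_{k,i}.$$ -/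

import Mathlib

open Filter Topology

/-- Plane rooted trees in which every vertex carries a natural number as a label and every non-leaf
vertex has one child or two (ordered) children. -/
inductive OneTwoTree : Type
  | leaf (a : ℕ) : OneTwoTree
  | unary (a : ℕ) (t : OneTwoTree) : OneTwoTree
  | binary (a : ℕ) (l r : OneTwoTree) : OneTwoTree

namespace OneTwoTree

/-- The label of the root. -/
def rootLabel : OneTwoTree → ℕ
  | leaf a => a
  | unary a _ => a
  | binary a _ _ => a

/-- The list of the subtrees of all vertices: one entry for each vertex `v`, namely the tree formed
by `v` and all its descendants. -/
def subtrees : OneTwoTree → List OneTwoTree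
  | leaf a => [leaf a]
  | unary a t => unary a t :: t.subtrees
  | binary a l r => binary a l r :: (l.subtrees ++ r.subtrees)

/-- The number of vertices. -/
def size (t : OneTwoTree) : ℕ := t.subtrees.length

/-- The list of the labels of all vertices. -/
def labels (t : OneTwoTree) : List ℕ := t.subtrees.map rootLabel

/-- The label of each non-root vertex is less than that of its parent. -/
def Decreasing : OneTwoTree → Prop
  | leaf _ => True
  | unary a t => t.rootLabel < a ∧ t.Decreasing
  | binary a l r => l.rootLabel < a ∧ r.rootLabel < a ∧ l.Decreasing ∧ r.Decreasing

/-- The list, over all leaves of the tree, of the number of edges of the path from the root to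
that leaf. -/
def leafDepths : OneTwoTree → List ℕ
  | leaf _ => [0]
  | unary _ t => t.leafDepths.map (· + 1)
  | binary _ l r => (l.leafDepths ++ r.leafDepths).map (· + 1)

/-- The rank of the root: the number of edges in the shortest path from the root to a leaf.
The rank of a vertex `v` of a tree is the rank of the root of the subtree of `v`. -/
noncomputable def rank (t : OneTwoTree) : ℕ := sInf {d | d ∈ t.leafDepths}

/-- `T` is a decreasing plane 1-2 tree on the vertex set `{1, …, n}`: its labels are `1, …, n`,
each used exactly once, and they decrease from parent to child. -/
def IsDecreasingOn (n : ℕ) (T : OneTwoTree) : Prop :=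
  (T.labels : Multiset ℕ) = (Finset.Icc 1 n).val ∧ T.Decreasing

theorem size_pos (t : OneTwoTree) : 0 < t.size := by
  cases t <;> simp [size, subtrees]

/-- There are finitely many trees of bounded size with labels in a given finite set. -/
theorem finite_of_labels (S : Finset ℕ) (m : ℕ) :
    {t : OneTwoTree | t.size ≤ m ∧ ∀ a ∈ t.labels, a ∈ S}.Finite := by
  induction m with
  | zero =>
    refine Set.finite_empty.subset ?_
    rintro t ⟨h, -⟩
    have := t.size_pos
    omega
  | succ m ih =>
    refine (((S.finite_toSet.image leaf).union
      ((S.finite_toSet.prod ih).image fun p => unary p.1 p.2)).union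
      ((S.finite_toSet.prod (ih.prod ih)).image fun p => binary p.1 p.2.1 p.2.2)).subset ?_
    rintro t ⟨h, hl⟩
    cases t with
    | leaf a =>
      exact Or.inl (Or.inl ⟨a, hl a (by simp [labels, subtrees, rootLabel]), rfl⟩)
    | unary a t =>
      refine Or.inl (Or.inr ⟨(a, t), ⟨hl a (by simp [labels, subtrees, rootLabel]), ?_, ?_⟩, rfl⟩)
      · simp only [size, subtrees, List.length_cons] at h ⊢; omega
      · exact fun b hb => hl b (List.mem_cons_of_mem _ hb)
    | binary a l r =>
      simp only [size, subtrees, List.length_cons, List.length_append] at h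
      simp only [labels, subtrees, List.map_cons, List.map_append, List.mem_cons,
        List.mem_append] at hl
      refine Or.inr ⟨(a, l, r), ⟨hl a (Or.inl rfl), ⟨?_, ?_⟩, ⟨?_, ?_⟩⟩, rfl⟩
      · simp only [size]; omega
      · exact fun b hb => hl b (Or.inr (Or.inl hb))
      · simp only [size]; omega
      · exact fun b hb => hl b (Or.inr (Or.inr hb))

theorem finite_isDecreasingOn (n : ℕ) : {T : OneTwoTree | IsDecreasingOn n T}.Finite := by
  refine (finite_of_labels (Finset.Icc 1 n) n).subset ?_
  rintro t ⟨h, -⟩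
  constructor
  · have h' := congrArg Multiset.card h
    simp [labels] at h'
    exact h'.le
  · intro a ha
    rw [← Finset.mem_val, ← h]
    exact Multiset.mem_coe.2 ha

/-- The finite set of all decreasing plane 1-2 trees on the vertex set `{1, …, n}`. -/
noncomputable def trees (n : ℕ) : Finset OneTwoTree := (finite_isDecreasingOn n).toFinset

/-- The probability that the subtree of a vertex, chosen uniformly at random among all vertices of
all decreasing plane 1-2 trees on `{1, …, n}`, has the property `P`. -/
noncomputable def vertexProb (n : ℕ) (P : OneTwoTree → Prop) [DecidablePred P] : ℝ :=
  ((∑ T ∈ trees n, T.subtrees.countP (fun s => decide (P s)) : ℕ) : ℝ) /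
    ((∑ T ∈ trees n, T.size : ℕ) : ℝ)

/-- The probability that a random vertex has rank `k`. -/
noncomputable def rankProb (n k : ℕ) : ℝ := vertexProb n fun s => s.rank = k

/-- The probability that a random vertex has rank `k` and its subtree has exactly `i` vertices. -/
noncomputable def rankSizeProb (n k i : ℕ) : ℝ :=
  vertexProb n fun s => s.rank = k ∧ s.size = i

end OneTwoTree

/-!
Let `t n` be the number of decreasing plane 1-2 trees on `n` vertices. Removing the root of such a
tree (the vertex with the largest label) shows that the exponential generating function `T` of `t`
solves `T' = 1 + T + T²`, `T(0) = 0`, so `T = -1/2 + √3/2 cot (√3/2 (ρ - z))` with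
`ρ = 2π / (3√3)`; see `card_trees_succ` and `iteratedDeriv_egf`. Its only singularity in the disc
`|z| < 2ρ` is a simple pole at `ρ`, hence `t n / n! ~ ρ ^ (-n - 1)` (`tendsto_card_trees`).

Whether a subtree has a given size and rank depends only on its shape. For a shape-invariant
property that only trees of size `i + 1` have, the number of vertices whose subtree has the property
therefore satisfies a linear recurrence (`vertexCount_succ`), with exponential generating function
`p / i! · T'(z) · ∫₀ᶻ xⁱ / T'(x) dx`, where `p` is the number of trees with the property
(`vertexCount_eq_iteratedDeriv`). As `1 / T'` is entire, the singularity of this function at `ρ` is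
the double pole of `T'`, and the quotient of the number of vertices with the property by the total
number `n · t n` of vertices converges to `p / (i! ρ) · ∫₀^ρ xⁱ / T'(x) dx` (`tendsto_vertexProb`).
This gives the limits `w`.

For the interchange of limit and sum, the property "the subtree has size `i + 1`" alone has
`p = t (i + 1)`, and the limiting probabilities sum to `1/ρ · ∫₀^ρ T' / T' = 1`
(`hasSum_sizeIntegral`): in the limit no mass escapes to subtrees of unbounded size. Since the
probabilities for rank and size are dominated by those for size alone, the sums over the size
converge to the sum of the limits (`summable_and_tendsto_of_le_of_hasSum_one`).
-/

open scoped Nat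

/-! ### Relabelling -/

namespace OneTwoTree

/-- The tree of the same shape in which every label `a` is replaced by `f a`. -/
def relabel (f : ℕ → ℕ) : OneTwoTree → OneTwoTree
  | leaf a => leaf (f a)
  | unary a t => unary (f a) (t.relabel f)
  | binary a l r => binary (f a) (l.relabel f) (r.relabel f)

theorem rootLabel_relabel (f : ℕ → ℕ) (t : OneTwoTree) :
    (t.relabel f).rootLabel = f t.rootLabel := by
  cases t <;> rfl

theorem subtrees_relabel (f : ℕ → ℕ) (t : OneTwoTree) :
    (t.relabel f).subtrees = t.subtrees.map (relabel f) := by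
  induction t with
  | leaf a => rfl
  | unary a t ih => simp [relabel, subtrees, ih]
  | binary a l r ihl ihr => simp [relabel, subtrees, ihl, ihr]

theorem labels_relabel (f : ℕ → ℕ) (t : OneTwoTree) :
    (t.relabel f).labels = t.labels.map f := by
  simp [labels, subtrees_relabel, Function.comp_def, rootLabel_relabel]

theorem size_relabel (f : ℕ → ℕ) (t : OneTwoTree) : (t.relabel f).size = t.size := by
  simp [size, subtrees_relabel]

theorem leafDepths_relabel (f : ℕ → ℕ) (t : OneTwoTree) :
    (t.relabel f).leafDepths = t.leafDepths := by
  induction t with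
  | leaf a => rfl
  | unary a t ih => simp [relabel, leafDepths, ih]
  | binary a l r ihl ihr => simp [relabel, leafDepths, ihl, ihr]

theorem rank_relabel (f : ℕ → ℕ) (t : OneTwoTree) : (t.relabel f).rank = t.rank := by
  simp [rank, leafDepths_relabel]

theorem labels_leaf (a : ℕ) : (leaf a).labels = [a] := rfl

theorem labels_unary (a : ℕ) (t : OneTwoTree) : (unary a t).labels = a :: t.labels := rfl

theorem labels_binary (a : ℕ) (l r : OneTwoTree) :
    (binary a l r).labels = a :: (l.labels ++ r.labels) := by
  simp [labels, subtrees, rootLabel]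

theorem rootLabel_mem_labels (t : OneTwoTree) : t.rootLabel ∈ t.labels := by
  cases t <;> simp [labels, subtrees, rootLabel]

theorem length_labels (t : OneTwoTree) : t.labels.length = t.size := by
  simp [labels, size]

theorem relabel_relabel_of_leftInverse {f g : ℕ → ℕ} {t : OneTwoTree}
    (h : ∀ a ∈ t.labels, g (f a) = a) : (t.relabel f).relabel g = t := by
  induction t with
  | leaf a => simpa [relabel, labels_leaf] using h
  | unary a t ih =>
    simp only [labels_unary, List.mem_cons, forall_eq_or_imp] at h
    simp [relabel, h.1, ih h.2]
  | binary a l r ihl ihr =>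
    simp only [labels_binary, List.mem_cons, List.mem_append, forall_eq_or_imp] at h
    simp [relabel, h.1, ihl fun a ha => h.2 a (Or.inl ha), ihr fun a ha => h.2 a (Or.inr ha)]

theorem Decreasing.relabel {f : ℕ → ℕ} {t : OneTwoTree} (ht : t.Decreasing)
    (hf : StrictMonoOn f {a | a ∈ t.labels}) : (t.relabel f).Decreasing := by
  induction t with
  | leaf a => trivial
  | unary a t ih =>
    refine ⟨?_, ih ht.2 (hf.mono fun b hb => by simp_all [labels_unary])⟩
    rw [rootLabel_relabel]
    exact hf (by simp [labels_unary, rootLabel_mem_labels]) (by simp [labels_unary]) ht.1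
  | binary a l r ihl ihr =>
    refine ⟨?_, ?_, ihl ht.2.2.1 (hf.mono fun b hb => by simp_all [labels_binary]),
      ihr ht.2.2.2 (hf.mono fun b hb => by simp_all [labels_binary])⟩
    · rw [rootLabel_relabel]
      exact hf (by simp [labels_binary, rootLabel_mem_labels]) (by simp [labels_binary]) ht.1
    · rw [rootLabel_relabel]
      exact hf (by simp [labels_binary, rootLabel_mem_labels]) (by simp [labels_binary]) ht.2.1

theorem Decreasing.le_rootLabel {t : OneTwoTree} (ht : t.Decreasing) :
    ∀ a ∈ t.labels, a ≤ t.rootLabel := by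
  induction t with
  | leaf a => simp [labels_leaf, rootLabel]
  | unary a t ih =>
    simp only [labels_unary, List.mem_cons, forall_eq_or_imp]
    exact ⟨le_rfl, fun b hb => (ih ht.2 b hb).trans ht.1.le⟩
  | binary a l r ihl ihr =>
    simp only [labels_binary, List.mem_cons, List.mem_append, forall_eq_or_imp]
    refine ⟨le_rfl, ?_⟩
    rintro b (hb | hb)
    · exact (ihl ht.2.2.1 b hb).trans ht.1.le
    · exact (ihr ht.2.2.2 b hb).trans ht.2.1.le

/-! ### Decreasing trees on an arbitrary label set -/

theorem finite_decreasing_labels (S : Finset ℕ) :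
    {T : OneTwoTree | (T.labels : Multiset ℕ) = S.val ∧ T.Decreasing}.Finite := by
  refine (finite_of_labels S S.card).subset ?_
  rintro t ⟨h, -⟩
  refine ⟨?_, fun a ha => ?_⟩
  · rw [← length_labels, Finset.card_def, ← h, Multiset.coe_card]
  · rw [← Finset.mem_val, ← h]
    exact Multiset.mem_coe.2 ha

/-- The finite set of decreasing plane 1-2 trees whose labels are the elements of `S`, each used
exactly once. -/
noncomputable def treesOn (S : Finset ℕ) : Finset OneTwoTree :=
  (finite_decreasing_labels S).toFinset

theorem mem_treesOn {S : Finset ℕ} {T : OneTwoTree} :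
    T ∈ treesOn S ↔ (T.labels : Multiset ℕ) = S.val ∧ T.Decreasing := by
  simp [treesOn]

theorem trees_eq_treesOn (n : ℕ) : trees n = treesOn (Finset.Icc 1 n) := by
  ext T
  simp [trees, mem_treesOn, IsDecreasingOn]

theorem mem_of_mem_labels {S : Finset ℕ} {T : OneTwoTree} (hT : T ∈ treesOn S) {a : ℕ} :
    a ∈ T.labels ↔ a ∈ S := by
  rw [← Finset.mem_val, ← (mem_treesOn.1 hT).1, Multiset.mem_coe]

theorem size_of_mem_treesOn {S : Finset ℕ} {T : OneTwoTree} (hT : T ∈ treesOn S) :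
    T.size = S.card := by
  rw [← length_labels, Finset.card_def, ← (mem_treesOn.1 hT).1, Multiset.coe_card]

theorem size_of_mem_trees {n : ℕ} {T : OneTwoTree} (hT : T ∈ trees n) : T.size = n := by
  rw [trees_eq_treesOn] at hT
  simp [size_of_mem_treesOn hT]

/-- The order isomorphism of two finite sets of the same size, as a function `f` on all natural
numbers, with a left inverse `g`. -/
theorem exists_strictMonoOn_of_card_eq {S S' : Finset ℕ} (h : S.card = S'.card) :
    ∃ f g : ℕ → ℕ, StrictMonoOn f S ∧ S.image f = S' ∧ ∀ a ∈ S, g (f a) = a := by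
  classical
  let e : S ≃o S' := (S.orderIsoOfFin h).symm.trans (S'.orderIsoOfFin rfl)
  let f : ℕ → ℕ := fun a => if ha : a ∈ S then (e ⟨a, ha⟩ : ℕ) else 0
  let g : ℕ → ℕ := fun a => if ha : a ∈ S' then (e.symm ⟨a, ha⟩ : ℕ) else 0
  have hf : ∀ a (ha : a ∈ S), f a = e ⟨a, ha⟩ := fun a ha => dif_pos ha
  have hg : ∀ a (ha : a ∈ S'), g a = e.symm ⟨a, ha⟩ := fun a ha => dif_pos ha
  refine ⟨f, g, ?_, ?_, ?_⟩
  · intro a ha b hb hab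
    rw [hf a ha, hf b hb, Subtype.coe_lt_coe]
    exact e.strictMono hab
  · ext b
    simp only [Finset.mem_image]
    constructor
    · rintro ⟨a, ha, rfl⟩
      rw [hf a ha]
      exact (e ⟨a, ha⟩).2
    · intro hb
      refine ⟨e.symm ⟨b, hb⟩, (e.symm ⟨b, hb⟩).2, ?_⟩
      rw [hf _ (e.symm ⟨b, hb⟩).2]
      simp
  · intro a ha
    rw [hf a ha, hg _ (e ⟨a, ha⟩).2]
    simp

theorem sum_treesOn_le_of_card_eq {F : OneTwoTree → ℕ} (hF : ∀ f T, F (relabel f T) = F T)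
    {S S' : Finset ℕ} (h : S.card = S'.card) :
    ∑ T ∈ treesOn S, F T ≤ ∑ T ∈ treesOn S', F T := by
  classical
  obtain ⟨f, g, hf, hS', hg⟩ := exists_strictMonoOn_of_card_eq h
  have hinj : Set.InjOn (relabel f) (treesOn S : Set OneTwoTree) := by
    intro T hT T' hT' hTT'
    have h1 := relabel_relabel_of_leftInverse (f := f) (g := g) (t := T)
      fun a ha => hg a ((mem_of_mem_labels hT).1 ha)
    have h2 := relabel_relabel_of_leftInverse (f := f) (g := g) (t := T')
      fun a ha => hg a ((mem_of_mem_labels hT').1 ha)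
    rw [← h1, ← h2, hTT']
  calc ∑ T ∈ treesOn S, F T = ∑ T ∈ treesOn S, F (relabel f T) := by simp [hF]
    _ = ∑ T ∈ (treesOn S).image (relabel f), F T := (Finset.sum_image hinj).symm
    _ ≤ ∑ T ∈ treesOn S', F T := by
        refine Finset.sum_le_sum_of_subset fun T hT => ?_
        obtain ⟨t, ht, rfl⟩ := Finset.mem_image.1 hT
        have hT' := mem_treesOn.1 ht
        refine mem_treesOn.2 ⟨?_, hT'.2.relabel (hf.mono fun a ha => (mem_of_mem_labels ht).1 ha)⟩
        rw [labels_relabel, ← Multiset.map_coe, hT'.1, ← hS', Finset.image_val_of_injOn hf.injOn]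

/-- The sum over all decreasing trees of a statistic that depends only on the shape is determined
by the number of labels. -/
theorem sum_treesOn_of_shapeInvariant {F : OneTwoTree → ℕ} (hF : ∀ f T, F (relabel f T) = F T)
    (S : Finset ℕ) : ∑ T ∈ treesOn S, F T = ∑ T ∈ trees S.card, F T := by
  rw [trees_eq_treesOn]
  exact le_antisymm (sum_treesOn_le_of_card_eq hF (by simp))
    (sum_treesOn_le_of_card_eq hF (by simp))

/-! ### Removing the root -/

/-- A decreasing tree whose largest label is `m` has root label `m`; removing the root leaves
nothing, one tree on the remaining labels, or two trees on complementary sets of labels. -/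
theorem sum_treesOn_insert (G : OneTwoTree → ℕ) {R : Finset ℕ} {m : ℕ} (hm : ∀ a ∈ R, a < m) :
    ∑ T ∈ treesOn (insert m R), G T =
      (if R = ∅ then G (leaf m) else 0) + ∑ t ∈ treesOn R, G (unary m t) +
        ∑ A ∈ R.powerset, ∑ l ∈ treesOn A, ∑ r ∈ treesOn (R \ A), G (binary m l r) := by
  classical
  have hmR : m ∉ R := fun h => (hm m h).false
  have hval : (insert m R).val = m ::ₘ R.val := Finset.insert_val_of_notMem hmR
  let X : Finset OneTwoTree := if R = ∅ then {leaf m} else ∅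
  let Y : Finset OneTwoTree := (treesOn R).image (unary m)
  let Z : Finset OneTwoTree := (R.powerset.sigma fun A => treesOn A ×ˢ treesOn (R \ A)).image
    fun p => binary m p.2.1 p.2.2
  have hX : ∀ T, T ∈ X ↔ R = ∅ ∧ T = leaf m := by
    intro T
    by_cases hR : R = ∅ <;> simp [X, hR]
  have hXsum : ∑ T ∈ X, G T = if R = ∅ then G (leaf m) else 0 := by
    by_cases hR : R = ∅ <;> simp [X, hR]
  have hYsum : ∑ T ∈ Y, G T = ∑ t ∈ treesOn R, G (unary m t) :=
    Finset.sum_image fun a _ b _ h => by simpa using h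
  have hZsum : ∑ T ∈ Z, G T =
      ∑ A ∈ R.powerset, ∑ l ∈ treesOn A, ∑ r ∈ treesOn (R \ A), G (binary m l r) := by
    rw [Finset.sum_image, Finset.sum_sigma]
    · simp only [Finset.sum_product]
    · rintro ⟨A, l, r⟩ hA ⟨B, l', r'⟩ hB h
      simp only [binary.injEq, true_and] at h
      obtain ⟨rfl, rfl⟩ := h
      simp only [Finset.coe_sigma, Set.mem_sigma_iff, Finset.mem_coe, Finset.mem_product] at hA hB
      have : A = B := Finset.val_injective
        ((mem_treesOn.1 hA.2.1).1.symm.trans (mem_treesOn.1 hB.2.1).1)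
      subst this
      rfl
  have hXY : Disjoint X Y := by
    rw [Finset.disjoint_left]
    intro T hT hT'
    obtain ⟨-, rfl⟩ := (hX T).1 hT
    simp [Y] at hT'
  have hXYZ : Disjoint (X ∪ Y) Z := by
    rw [Finset.disjoint_left]
    intro T hT hT'
    obtain ⟨p, -, rfl⟩ := Finset.mem_image.1 hT'
    rcases Finset.mem_union.1 hT with h | h
    · simpa using ((hX _).1 h).2
    · simp [Y] at h
  have hunion : treesOn (insert m R) = X ∪ Y ∪ Z := by
    ext T
    rw [Finset.mem_union, Finset.mem_union, hX]
    constructor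
    · intro hT
      have hroot : T.rootLabel = m := by
        refine le_antisymm ?_ ((mem_treesOn.1 hT).2.le_rootLabel m
          ((mem_of_mem_labels hT).2 (by simp)))
        have := (mem_of_mem_labels hT).1 T.rootLabel_mem_labels
        rcases Finset.mem_insert.1 this with h | h
        · exact h.le
        · exact (hm _ h).le
      obtain ⟨hl, hd⟩ := mem_treesOn.1 hT
      rw [hval] at hl
      cases T with
      | leaf a =>
        obtain rfl : a = m := hroot
        refine Or.inl (Or.inl ⟨?_, rfl⟩)
        rw [labels_leaf, ← Multiset.cons_coe, Multiset.cons_inj_right] at hl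
        exact Finset.val_eq_zero.1 hl.symm
      | unary a t =>
        obtain rfl : a = m := hroot
        refine Or.inl (Or.inr (Finset.mem_image_of_mem _ (mem_treesOn.2 ⟨?_, hd.2⟩)))
        rwa [labels_unary, ← Multiset.cons_coe, Multiset.cons_inj_right] at hl
      | binary a l r =>
        obtain rfl : a = m := hroot
        rw [labels_binary, ← Multiset.cons_coe, Multiset.cons_inj_right, ← Multiset.coe_add] at hl
        have hle : (l.labels : Multiset ℕ) ≤ R.val := hl ▸ Multiset.le_add_right _ _
        let A : Finset ℕ := ⟨l.labels, Multiset.nodup_of_le hle R.nodup⟩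
        refine Or.inr (Finset.mem_image.2 ⟨⟨A, l, r⟩, ?_, rfl⟩)
        rw [Finset.mem_sigma, Finset.mem_product]
        refine ⟨Finset.mem_powerset.2 (Finset.val_le_iff.1 hle), mem_treesOn.2 ⟨rfl, hd.2.2.1⟩,
          mem_treesOn.2 ⟨?_, hd.2.2.2⟩⟩
        rw [Finset.sdiff_val, ← hl]
        exact (add_tsub_cancel_left _ _).symm
    · rintro ((⟨rfl, rfl⟩ | h) | h)
      · exact mem_treesOn.2 ⟨by rfl, trivial⟩
      · obtain ⟨t, ht, rfl⟩ := Finset.mem_image.1 h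
        have ht' := mem_treesOn.1 ht
        refine mem_treesOn.2 ⟨?_, hm _ ((mem_of_mem_labels ht).1 t.rootLabel_mem_labels), ht'.2⟩
        rw [labels_unary, ← Multiset.cons_coe, ht'.1, hval]
      · obtain ⟨⟨A, l, r⟩, hp, rfl⟩ := Finset.mem_image.1 h
        rw [Finset.mem_sigma, Finset.mem_product, Finset.mem_powerset] at hp
        obtain ⟨hA, hl, hr⟩ := hp
        have hl' := mem_treesOn.1 hl
        have hr' := mem_treesOn.1 hr
        refine mem_treesOn.2 ⟨?_, hm _ (hA ((mem_of_mem_labels hl).1 l.rootLabel_mem_labels)),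
          hm _ (Finset.sdiff_subset ((mem_of_mem_labels hr).1 r.rootLabel_mem_labels)),
          hl'.2, hr'.2⟩
        rw [labels_binary, ← Multiset.cons_coe, ← Multiset.coe_add, hl'.1, hr'.1, hval,
          Finset.sdiff_val, add_tsub_cancel_of_le (Finset.val_le_iff.2 hA)]
  rw [hunion, Finset.sum_union hXYZ, Finset.sum_union hXY, hXsum, hYsum, hZsum]

theorem sum_trees_succ (G : OneTwoTree → ℕ) (n : ℕ) :
    ∑ T ∈ trees (n + 1), G T =
      (if n = 0 then G (leaf 1) else 0) + ∑ t ∈ trees n, G (unary (n + 1) t) +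
        ∑ A ∈ (Finset.Icc 1 n).powerset, ∑ l ∈ treesOn A, ∑ r ∈ treesOn (Finset.Icc 1 n \ A),
          G (binary (n + 1) l r) := by
  have h : Finset.Icc 1 (n + 1) = insert (n + 1) (Finset.Icc 1 n) := by
    ext a
    simp only [Finset.mem_Icc, Finset.mem_insert]
    omega
  rw [trees_eq_treesOn, trees_eq_treesOn, h, sum_treesOn_insert G (by simp)]
  rcases Nat.eq_zero_or_pos n with rfl | hn
  · simp
  · rw [if_neg (by simp; omega), if_neg (by omega)]

theorem trees_zero : trees 0 = ∅ := by
  refine Finset.eq_empty_of_forall_notMem fun T hT => ?_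
  have := T.size_pos
  have := size_of_mem_trees hT
  omega

theorem card_treesOn (S : Finset ℕ) : (treesOn S).card = (trees S.card).card := by
  simpa using sum_treesOn_of_shapeInvariant (F := fun _ => 1) (fun _ _ => rfl) S

theorem sum_powerset_mul_compl (n : ℕ) (a b : ℕ → ℕ) :
    ∑ A ∈ (Finset.Icc 1 n).powerset, a A.card * b (Finset.Icc 1 n \ A).card =
      ∑ j ∈ Finset.range (n + 1), n.choose j * (a j * b (n - j)) := by
  have h := Finset.sum_powerset_apply_card (fun j => a j * b (n - j)) (x := Finset.Icc 1 n)
  simp only [Nat.card_Icc, Nat.add_sub_cancel, smul_eq_mul] at h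
  rw [← h]
  refine Finset.sum_congr rfl fun A hA => ?_
  rw [Finset.card_sdiff_of_subset (Finset.mem_powerset.1 hA)]
  simp

/-- The recurrence for the number of decreasing trees. -/
theorem card_trees_succ (n : ℕ) :
    (trees (n + 1)).card = (if n = 0 then 1 else 0) + (trees n).card +
      ∑ j ∈ Finset.range (n + 1), n.choose j * ((trees j).card * (trees (n - j)).card) := by
  have h := sum_trees_succ (fun _ => 1) n
  simp only [Finset.sum_const, smul_eq_mul, mul_one, card_treesOn] at h
  rw [h, sum_powerset_mul_compl n (fun j => (trees j).card) (fun j => (trees j).card)]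

/-- The number of pairs `(T, v)` where `T` is a decreasing tree on `{1, …, n}` and `v` is one of its
vertices, such that the subtree of `v` satisfies `P`. -/
noncomputable def vertexCount (P : OneTwoTree → Prop) [DecidablePred P] (n : ℕ) : ℕ :=
  ∑ T ∈ trees n, T.subtrees.countP (fun s => decide (P s))

theorem countP_relabel {P : OneTwoTree → Prop} [DecidablePred P]
    (hP : ∀ f T, P (relabel f T) ↔ P T) (f : ℕ → ℕ) (T : OneTwoTree) :
    (relabel f T).subtrees.countP (fun s => decide (P s)) =
      T.subtrees.countP (fun s => decide (P s)) := by
  rw [subtrees_relabel, List.countP_map]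
  congr 1
  ext s
  simp [hP]

/-- The recurrence for `vertexCount`: the chosen vertex is the root, or lies in one of the trees
that remain when the root is removed. -/
theorem vertexCount_succ {P : OneTwoTree → Prop} [DecidablePred P]
    (hP : ∀ f T, P (relabel f T) ↔ P T) (n : ℕ) :
    vertexCount P (n + 1) = ((trees (n + 1)).filter P).card + vertexCount P n +
      2 * ∑ j ∈ Finset.range (n + 1), n.choose j * ((trees j).card * vertexCount P (n - j)) := by
  set N : OneTwoTree → ℕ := fun T => T.subtrees.countP (fun s => decide (P s)) with hN
  have hinv : ∀ S, ∑ T ∈ treesOn S, N T = vertexCount P S.card :=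
    sum_treesOn_of_shapeInvariant (countP_relabel hP)
  -- The number of non-root vertices of `T` that are counted.
  let G : OneTwoTree → ℕ := fun T => match T with
    | leaf _ => 0
    | unary _ t => N t
    | binary _ l r => N l + N r
  have hG : ∀ T, N T = (if P T then 1 else 0) + G T := by
    intro T
    cases T <;> simp [hN, G, subtrees, List.countP_cons] <;> ring
  have h1 : vertexCount P (n + 1) =
      ((trees (n + 1)).filter P).card + ∑ T ∈ trees (n + 1), G T := by
    rw [Finset.card_filter, ← Finset.sum_add_distrib]
    exact Finset.sum_congr rfl fun T _ => hG T
  have h2 := sum_trees_succ G n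
  have hsplit : ∀ A ∈ (Finset.Icc 1 n).powerset,
      ∑ l ∈ treesOn A, ∑ r ∈ treesOn (Finset.Icc 1 n \ A), (N l + N r) =
        vertexCount P A.card * (trees (Finset.Icc 1 n \ A).card).card +
          (trees A.card).card * vertexCount P (Finset.Icc 1 n \ A).card := by
    intro A _
    simp only [Finset.sum_add_distrib, Finset.sum_const, smul_eq_mul, ← Finset.mul_sum, hinv,
      card_treesOn]
    ring
  have hcomm : ∑ j ∈ Finset.range (n + 1),
      n.choose j * (vertexCount P j * (trees (n - j)).card) =
      ∑ j ∈ Finset.range (n + 1), n.choose j * ((trees j).card * vertexCount P (n - j)) := by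
    rw [← Finset.sum_range_reflect]
    refine Finset.sum_congr rfl fun j hj => ?_
    have hj' : j ≤ n := by simpa [Nat.lt_succ_iff] using hj
    rw [show n + 1 - 1 - j = n - j by omega, Nat.choose_symm hj', Nat.sub_sub_self hj', mul_comm
      (vertexCount P _)]
  have h3 : ∑ T ∈ trees (n + 1), G T = vertexCount P n +
      2 * ∑ j ∈ Finset.range (n + 1), n.choose j * ((trees j).card * vertexCount P (n - j)) := by
    rw [h2]
    simp only [G]
    rw [Finset.sum_congr rfl hsplit, Finset.sum_add_distrib,
      sum_powerset_mul_compl n (vertexCount P) (fun j => (trees j).card),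
      sum_powerset_mul_compl n (fun j => (trees j).card) (vertexCount P), hcomm]
    simp only [ite_self, vertexCount, hN]
    ring
  rw [h1, h3, add_assoc]

end OneTwoTree

/-! ### Taylor coefficients of functions with a polar singularity -/

/-- The `n`-th Taylor coefficient at `0`. -/
noncomputable def taylorCoeffZero (f : ℂ → ℂ) (n : ℕ) : ℂ := iteratedDeriv n f 0 / n !

theorem iteratedDeriv_const_sub_id_mul {f : ℂ → ℂ} (hf : AnalyticAt ℂ f 0) (c : ℂ) (n : ℕ) :
    iteratedDeriv (n + 1) (fun z => (c - z) * f z) 0 =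
      c * iteratedDeriv (n + 1) f 0 - (n + 1) * iteratedDeriv n f 0 := by
  have h0 : deriv (fun z : ℂ => c - z) = fun _ => -1 := by
    ext z
    simp
  have h1 : ∀ i, iteratedDeriv (i + 1 + 1) (fun z : ℂ => c - z) 0 = 0 := by
    intro i
    rw [iteratedDeriv_succ', h0, iteratedDeriv_succ']
    simp
  rw [iteratedDeriv_fun_mul (by fun_prop) hf.contDiffAt, Finset.sum_range_succ',
    Finset.sum_range_succ']
  simp only [h1]
  simp [h0]
  ring

theorem taylorCoeffZero_const_sub_id_mul {f : ℂ → ℂ} (hf : AnalyticAt ℂ f 0) (c : ℂ) (n : ℕ) :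
    taylorCoeffZero (fun z => (c - z) * f z) (n + 1) =
      c * taylorCoeffZero f (n + 1) - taylorCoeffZero f n := by
  have h1 : ((n : ℂ) + 1) ≠ 0 := by exact_mod_cast n.succ_ne_zero
  have h2 : (n ! : ℂ) ≠ 0 := by exact_mod_cast n.factorial_ne_zero
  simp only [taylorCoeffZero, iteratedDeriv_const_sub_id_mul hf, Nat.factorial_succ]
  push_cast
  field_simp

theorem sum_range_taylorCoeffZero_const_sub_id_mul {f : ℂ → ℂ} (hf : AnalyticAt ℂ f 0) (c : ℂ)
    (n : ℕ) :
    ∑ i ∈ Finset.range (n + 1), taylorCoeffZero (fun z => (c - z) * f z) i * c ^ i =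
      c ^ (n + 1) * taylorCoeffZero f n := by
  induction n with
  | zero => simp [taylorCoeffZero]
  | succ n ih =>
    rw [Finset.sum_range_succ, ih, taylorCoeffZero_const_sub_id_mul hf]
    ring

theorem taylorCoeffZero_congr {f g : ℂ → ℂ} (h : f =ᶠ[𝓝 0] g) (n : ℕ) :
    taylorCoeffZero f n = taylorCoeffZero g n := by
  rw [taylorCoeffZero, taylorCoeffZero, h.iteratedDeriv_eq]

/-- If `(ρ - z) f(z)` continues analytically beyond `|z| = ρ`, the partial sums of the Taylor series
of this product at `z = ρ` are the numbers `ρ ^ (n + 1) fₙ`, which therefore converge. -/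
theorem tendsto_taylorCoeffZero_of_simple_pole {f g : ℂ → ℂ} {ρ R : ℝ} (hρ : 0 < ρ) (hR : ρ < R)
    (hf : AnalyticAt ℂ f 0) (hg : DifferentiableOn ℂ g (Metric.ball 0 R))
    (hfg : (fun z => (ρ - z) * f z) =ᶠ[𝓝 0] g) :
    Tendsto (fun n => (ρ : ℂ) ^ (n + 1) * taylorCoeffZero f n) atTop (𝓝 (g ρ)) := by
  have h := Complex.hasSum_taylorSeries_on_ball hg (z := (ρ : ℂ))
    (by simpa [abs_of_pos hρ] using hR)
  have h' := (h.tendsto_sum_nat).comp (tendsto_add_atTop_nat 1)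
  refine h'.congr fun n => ?_
  rw [← sum_range_taylorCoeffZero_const_sub_id_mul hf]
  refine Finset.sum_congr rfl fun i _ => ?_
  rw [taylorCoeffZero_congr hfg, taylorCoeffZero]
  simp only [sub_zero, smul_eq_mul]
  ring

/-- For a double pole the coefficients grow linearly after scaling by `ρ ^ n`: their successive
differences converge by the case of a simple pole, and so do the Cesàro means of these. -/
theorem tendsto_taylorCoeffZero_of_double_pole {f g : ℂ → ℂ} {ρ R : ℝ} (hρ : 0 < ρ) (hR : ρ < R)
    (hf : AnalyticAt ℂ f 0) (hg : DifferentiableOn ℂ g (Metric.ball 0 R))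
    (hfg : (fun z => (ρ - z) ^ 2 * f z) =ᶠ[𝓝 0] g) :
    Tendsto (fun n : ℕ => (ρ : ℂ) ^ (n + 2) * taylorCoeffZero f n / n) atTop (𝓝 (g ρ)) := by
  have hf1 : AnalyticAt ℂ (fun z => (ρ - z) * f z) 0 := by fun_prop
  have h := tendsto_taylorCoeffZero_of_simple_pole hρ hR hf1 hg
    (hfg.mono fun z hz => by rw [← hz]; ring)
  have h1 := (h.comp (tendsto_add_atTop_nat 1)).cesaro_smul
  have h2 : Tendsto (fun n : ℕ => (ρ : ℂ) ^ 2 * taylorCoeffZero f 0 / n) atTop (𝓝 0) :=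
    tendsto_const_div_atTop_nhds_zero_nat _
  have h3 := h1.add h2
  rw [add_zero] at h3
  refine h3.congr fun n => ?_
  have h4 : ∀ i, (ρ : ℂ) ^ (i + 1 + 1) * taylorCoeffZero (fun z => (ρ - z) * f z) (i + 1) =
      (ρ : ℂ) ^ (i + 1 + 2) * taylorCoeffZero f (i + 1) -
        (ρ : ℂ) ^ (i + 2) * taylorCoeffZero f i := by
    intro i
    rw [taylorCoeffZero_const_sub_id_mul hf]
    ring
  simp only [Function.comp_apply, h4]
  rw [Finset.sum_range_sub (fun i => (ρ : ℂ) ^ (i + 2) * taylorCoeffZero f i)]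
  simp only [Complex.real_smul, zero_add]
  push_cast
  ring

/-! ### The exponential generating function of decreasing trees -/

namespace OneTwoTree

/-- The smallest positive singularity `2π / (3√3)` of the exponential generating function. -/
noncomputable def radius : ℝ := 2 * Real.pi / (3 * √3)

theorem radius_pos : 0 < radius := by
  unfold radius
  positivity

theorem half_sqrt_three_mul_radius : √3 / 2 * radius = Real.pi / 3 := by
  unfold radius
  field_simp

theorem half_sqrt_three_sq : ((√3 / 2 : ℝ) : ℂ) ^ 2 = 3 / 4 := by
  rw [← Complex.ofReal_pow, div_pow, Real.sq_sqrt (by norm_num)]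
  norm_num

theorem half_sqrt_three_ne_zero : ((√3 / 2 : ℝ) : ℂ) ≠ 0 := by
  rw [Complex.ofReal_ne_zero]
  positivity

/-- The argument `√3 / 2 * (ρ - z)` of the trigonometric functions in `egf`. -/
noncomputable def angle (z : ℂ) : ℂ := ((√3 / 2 : ℝ) : ℂ) * (radius - z)

theorem hasDerivAt_angle (z : ℂ) : HasDerivAt angle (-((√3 / 2 : ℝ) : ℂ)) z :=
  (((hasDerivAt_id z).const_sub (radius : ℂ)).const_mul ((√3 / 2 : ℝ) : ℂ)).congr_deriv (by simp)

theorem differentiable_angle : Differentiable ℂ angle := fun z =>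
  (hasDerivAt_angle z).differentiableAt

theorem angle_zero : angle 0 = ((Real.pi / 3 : ℝ) : ℂ) := by
  rw [angle, sub_zero, ← half_sqrt_three_mul_radius]
  push_cast
  ring

theorem angle_radius : angle radius = 0 := by
  simp [angle]

/-- The zeros of `sin ∘ angle` are the points `(1 - 3k) ρ` with `k` an integer. -/
theorem sin_angle_ne_zero {z : ℂ} (hz : z ∈ Metric.ball (0 : ℂ) (2 * radius))
    (hz' : z ≠ radius) : Complex.sin (angle z) ≠ 0 := by
  intro h
  obtain ⟨k, hk⟩ := Complex.sin_eq_zero_iff.1 h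
  have hpi : (Real.pi : ℂ) = 3 * (((√3 / 2 : ℝ) : ℂ) * radius) := by
    rw [← Complex.ofReal_mul, half_sqrt_three_mul_radius]
    push_cast
    ring
  have hzk : z = ((1 - 3 * k : ℤ) : ℂ) * radius := by
    rw [hpi, angle] at hk
    apply mul_left_cancel₀ half_sqrt_three_ne_zero
    push_cast at hk ⊢
    linear_combination -hk
  rw [mem_ball_zero_iff, hzk, norm_mul, Complex.norm_real, Real.norm_of_nonneg radius_pos.le,
    mul_lt_mul_iff_left₀ radius_pos, Complex.norm_intCast] at hz
  have hk2 : |1 - 3 * k| < 2 := by exact_mod_cast hz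
  rw [abs_lt] at hk2
  obtain rfl : k = 0 := by omega
  exact hz' (by simpa using hzk)

/-- The function `-1/2 + √3/2 cot (√3/2 (ρ - z))`, the solution of `T' = 1 + T + T²`, `T(0) = 0`. -/
noncomputable def egf (z : ℂ) : ℂ :=
  -1 / 2 + ((√3 / 2 : ℝ) : ℂ) * (Complex.cos (angle z) / Complex.sin (angle z))

/-- The entire function `4/3 sin² (√3/2 (ρ - z))`, the reciprocal of the derivative of `egf`. -/
noncomputable def recipDeriv (z : ℂ) : ℂ := 4 / 3 * Complex.sin (angle z) ^ 2

theorem differentiable_recipDeriv : Differentiable ℂ recipDeriv :=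
  (differentiable_angle.csin.pow 2).const_mul _

theorem recipDeriv_mul {z : ℂ} (hz : Complex.sin (angle z) ≠ 0) :
    recipDeriv z * (1 + egf z + egf z ^ 2) = 1 := by
  have h1 : 1 + egf z + egf z ^ 2 = 3 / 4 * (Complex.sin (angle z) ^ 2)⁻¹ := by
    have h : 1 + egf z + egf z ^ 2 =
        3 / 4 + ((√3 / 2 : ℝ) : ℂ) ^ 2 * (Complex.cos (angle z) / Complex.sin (angle z)) ^ 2 := by
      rw [egf]
      ring
    rw [h, half_sqrt_three_sq]
    field_simp
    linear_combination Complex.sin_sq_add_cos_sq (angle z)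
  rw [h1, recipDeriv]
  field_simp

theorem hasDerivAt_egf {z : ℂ} (hz : Complex.sin (angle z) ≠ 0) :
    HasDerivAt egf (1 + egf z + egf z ^ 2) z := by
  have h := ((((hasDerivAt_angle z).ccos.div (hasDerivAt_angle z).csin hz).const_mul
    ((√3 / 2 : ℝ) : ℂ)).const_add (-1 / 2 : ℂ))
  refine h.congr_deriv ?_
  apply mul_left_cancel₀ (left_ne_zero_of_mul (recipDeriv_mul hz ▸ one_ne_zero))
  rw [recipDeriv_mul hz, recipDeriv]
  trans 4 / 3 * ((√3 / 2 : ℝ) : ℂ) ^ 2 * (Complex.sin (angle z) ^ 2 + Complex.cos (angle z) ^ 2)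
  · field_simp
    ring
  · rw [half_sqrt_three_sq, Complex.sin_sq_add_cos_sq]
    norm_num

theorem egf_zero : egf 0 = 0 := by
  rw [egf, angle_zero, ← Complex.ofReal_cos, ← Complex.ofReal_sin, Real.cos_pi_div_three,
    Real.sin_pi_div_three, mul_div_cancel₀ _ half_sqrt_three_ne_zero]
  push_cast
  ring

theorem sin_angle_ne_zero_of_mem_ball {z : ℂ} (hz : z ∈ Metric.ball (0 : ℂ) radius) :
    Complex.sin (angle z) ≠ 0 := by
  have h := radius_pos
  refine sin_angle_ne_zero (Metric.ball_subset_ball (by linarith) hz) ?_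
  rintro rfl
  simp [abs_of_pos h] at hz

theorem ball_radius_mem_nhds : Metric.ball (0 : ℂ) radius ∈ 𝓝 0 :=
  Metric.ball_mem_nhds 0 radius_pos

theorem differentiableOn_egf : DifferentiableOn ℂ egf (Metric.ball 0 radius) := fun _ hz =>
  (hasDerivAt_egf (sin_angle_ne_zero_of_mem_ball hz)).differentiableAt.differentiableWithinAt

theorem analyticAt_egf : AnalyticAt ℂ egf 0 :=
  differentiableOn_egf.analyticAt ball_radius_mem_nhds

theorem deriv_egf_eventuallyEq :
    deriv egf =ᶠ[𝓝 0] fun z => 1 + egf z + egf z * egf z := by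
  filter_upwards [ball_radius_mem_nhds] with z hz
  rw [(hasDerivAt_egf (sin_angle_ne_zero_of_mem_ball hz)).deriv, sq]

/-- The Taylor coefficients of `egf` satisfy the recurrence for the number of decreasing trees. -/
theorem iteratedDeriv_egf (n : ℕ) : iteratedDeriv n egf 0 = (trees n).card := by
  induction n using Nat.strong_induction_on with
  | _ n ih =>
    cases n with
    | zero => simp [egf_zero, trees_zero]
    | succ n =>
      have hT : ContDiffAt ℂ n egf 0 := analyticAt_egf.contDiffAt
      rw [iteratedDeriv_succ', deriv_egf_eventuallyEq.iteratedDeriv_eq,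
        iteratedDeriv_fun_add (by fun_prop) (by fun_prop),
        iteratedDeriv_fun_add (by fun_prop) (by fun_prop), iteratedDeriv_fun_mul hT hT,
        ih n n.lt_succ_self, card_trees_succ, iteratedDeriv_const]
      push_cast
      congr 1
      refine Finset.sum_congr rfl fun j hj => ?_
      have hj' := Finset.mem_range.1 hj
      rw [ih j hj', ih (n - j) (by omega)]
      ring

/-- The count of vertices whose subtree has size `i + 1` and satisfies a shape-invariant property
has the generating function `p / i! · T' · F`, where `F' = zⁱ / T'` and `p` counts the trees of that
size with the property: this function solves the linear differential equation
`V' = (1 + 2 T) V + p zⁱ / i!` that corresponds to the recurrence for `vertexCount`. -/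
theorem vertexCount_eq_iteratedDeriv {P : OneTwoTree → Prop} [DecidablePred P]
    (hP : ∀ f T, P (relabel f T) ↔ P T) {i : ℕ} (hsize : ∀ T, P T → T.size = i + 1)
    {F : ℂ → ℂ} (hF : ∀ z, HasDerivAt F (z ^ i * recipDeriv z) z) (hF0 : F 0 = 0) (n : ℕ) :
    (vertexCount P n : ℂ) = ((trees (i + 1)).filter P).card / i ! *
      iteratedDeriv n (fun z => (1 + egf z + egf z ^ 2) * F z) 0 := by
  set V : ℂ → ℂ := fun z => (1 + egf z + egf z ^ 2) * F z with hV
  have hFd : Differentiable ℂ F := fun z => (hF z).differentiableAt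
  have hFa : AnalyticAt ℂ F 0 := hFd.analyticAt 0
  have hTa := analyticAt_egf
  have hVa : AnalyticAt ℂ V 0 := by fun_prop
  have hi : (i ! : ℂ) ≠ 0 := by exact_mod_cast i.factorial_ne_zero
  have hderiv : deriv V =ᶠ[𝓝 0] fun z => z ^ i + V z + 2 * (egf z * V z) := by
    filter_upwards [ball_radius_mem_nhds] with z hz
    have hs := sin_angle_ne_zero_of_mem_ball hz
    have hT := hasDerivAt_egf hs
    have hd : deriv V z = _ := (((hT.const_add 1).add (hT.pow 2)).mul (hF z)).deriv
    rw [hd]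
    simp only [Nat.cast_ofNat, Pi.add_apply, Pi.pow_apply, hV]
    linear_combination z ^ i * recipDeriv_mul hs
  have hroot : ∀ n, ((trees (n + 1)).filter P).card =
      if n = i then ((trees (i + 1)).filter P).card else 0 := by
    intro n
    split_ifs with h
    · rw [h]
    · rw [Finset.card_eq_zero, Finset.filter_eq_empty_iff]
      intro T hT hPT
      have := hsize T hPT
      rw [size_of_mem_trees hT] at this
      omega
  induction n using Nat.strong_induction_on with
  | _ n ih =>
    cases n with
    | zero => simp [vertexCount, trees_zero, hV, hF0]
    | succ n =>
      have hT : ContDiffAt ℂ n egf 0 := hTa.contDiffAt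
      have hVc : ContDiffAt ℂ n V 0 := hVa.contDiffAt
      rw [iteratedDeriv_succ', hderiv.iteratedDeriv_eq,
        iteratedDeriv_fun_add (by fun_prop) (by fun_prop),
        iteratedDeriv_fun_add (by fun_prop) (by fun_prop), iteratedDeriv_const_mul_field,
        iteratedDeriv_fun_mul hT hVc, iteratedDeriv_fun_pow_zero, vertexCount_succ hP, hroot,
        mul_add, mul_add]
      push_cast
      rw [ih n n.lt_succ_self]
      congr 1
      · congr 1
        split_ifs
        · field_simp
        · simp
      · rw [mul_left_comm, Finset.mul_sum _ _ (_ / _)]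
        congr 1
        refine Finset.sum_congr rfl fun j hj => ?_
        rw [ih (n - j) (by omega), iteratedDeriv_egf]
        ring

/-! ### Asymptotics of the coefficients -/

/-- The quotient of `sin (angle z)` by `z - radius`, without zeros in the disc of radius
`2 * radius`. -/
noncomputable def sinQuotient : ℂ → ℂ := dslope (fun z => Complex.sin (angle z)) radius

theorem sub_mul_sinQuotient (z : ℂ) : (z - radius) * sinQuotient z = Complex.sin (angle z) := by
  have h := sub_smul_dslope (fun z => Complex.sin (angle z)) (radius : ℂ) z
  simpa [angle_radius, sinQuotient] using h

theorem differentiable_sinQuotient : Differentiable ℂ sinQuotient := by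
  rw [← differentiableOn_univ]
  exact (Complex.differentiableOn_dslope univ_mem).2 differentiable_angle.csin.differentiableOn

theorem sinQuotient_radius : sinQuotient radius = -((√3 / 2 : ℝ) : ℂ) := by
  rw [sinQuotient, dslope_same, (hasDerivAt_angle _).csin.deriv, angle_radius]
  simp

theorem sinQuotient_ne_zero {z : ℂ} (hz : z ∈ Metric.ball (0 : ℂ) (2 * radius)) :
    sinQuotient z ≠ 0 := by
  by_cases h : z = radius
  · rw [h, sinQuotient_radius]
    exact neg_ne_zero.2 half_sqrt_three_ne_zero
  · intro h0
    apply sin_angle_ne_zero hz h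
    rw [← sub_mul_sinQuotient, h0, mul_zero]

theorem radius_lt_two_mul : radius < 2 * radius := by
  have := radius_pos
  linarith

/-- The number of decreasing trees on `n` vertices is asymptotic to `n! / ρ ^ (n + 1)`. -/
theorem tendsto_card_trees :
    Tendsto (fun n => radius ^ (n + 1) * ((trees n).card / n ! : ℝ)) atTop (𝓝 1) := by
  -- The continuation of `(ρ - z) T(z)` across `ρ`.
  let g : ℂ → ℂ := fun z => (radius - z) * (-1 / 2) +
    ((√3 / 2 : ℝ) : ℂ) * Complex.cos (angle z) / (-sinQuotient z)
  have hg : DifferentiableOn ℂ g (Metric.ball 0 (2 * radius)) := by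
    refine DifferentiableOn.add (by fun_prop) (DifferentiableOn.div ?_ ?_ ?_)
    · exact (differentiable_angle.ccos.const_mul _).differentiableOn
    · exact differentiable_sinQuotient.neg.differentiableOn
    · exact fun z hz => neg_ne_zero.2 (sinQuotient_ne_zero hz)
  have hfg : (fun z => (radius - z) * egf z) =ᶠ[𝓝 0] g := by
    filter_upwards [ball_radius_mem_nhds] with z hz
    have hs := sin_angle_ne_zero_of_mem_ball hz
    rw [← sub_mul_sinQuotient] at hs
    have h1 := left_ne_zero_of_mul hs
    have h2 := right_ne_zero_of_mul hs
    simp only [g, egf, ← sub_mul_sinQuotient]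
    field_simp
    ring
  have h := tendsto_taylorCoeffZero_of_simple_pole radius_pos radius_lt_two_mul
    analyticAt_egf hg hfg
  have hg1 : g radius = 1 := by
    simp only [g, sinQuotient_radius, angle_radius, Complex.cos_zero, sub_self, zero_mul, zero_add,
      neg_neg, mul_one]
    exact div_self half_sqrt_three_ne_zero
  rw [hg1] at h
  rw [← tendsto_ofReal_iff]
  refine Tendsto.congr (fun n => ?_) (by simpa using h)
  simp [taylorCoeffZero, iteratedDeriv_egf]

/-- The integral `∫₀^ρ xⁱ / T'(x) dx`. -/
noncomputable def sizeIntegral (i : ℕ) : ℝ :=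
  ∫ x in (0 : ℝ)..radius, x ^ i * (4 / 3 * Real.sin (√3 / 2 * (radius - x)) ^ 2)

theorem recipDeriv_ofReal (x : ℝ) :
    recipDeriv x = ((4 / 3 * Real.sin (√3 / 2 * (radius - x)) ^ 2 : ℝ) : ℂ) := by
  simp [recipDeriv, angle]

theorem vertexCount_asymptotics {P : OneTwoTree → Prop} [DecidablePred P]
    (hP : ∀ f T, P (relabel f T) ↔ P T) {i : ℕ} (hsize : ∀ T, P T → T.size = i + 1) :
    Tendsto (fun n : ℕ => radius ^ (n + 2) * (vertexCount P n / n ! : ℝ) / n) atTop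
      (𝓝 (((trees (i + 1)).filter P).card / i ! * sizeIntegral i)) := by
  have hd : Differentiable ℂ fun z : ℂ => z ^ i * recipDeriv z :=
    (differentiable_id.pow i).mul differentiable_recipDeriv
  obtain ⟨F₀, hF₀⟩ := hd.isExactOn_univ
  let F : ℂ → ℂ := fun z => F₀ z - F₀ 0
  have hF : ∀ z, HasDerivAt F (z ^ i * recipDeriv z) z := fun z =>
    (hF₀ z (Set.mem_univ z)).sub_const _
  have hF0 : F 0 = 0 := sub_self _
  have hFd : Differentiable ℂ F := fun z => (hF z).differentiableAt
  have hFint : F radius = (sizeIntegral i : ℂ) := by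
    have hderiv : ∀ x ∈ Set.uIcc 0 radius, HasDerivAt (fun y : ℝ => F y)
        ((x ^ i * (4 / 3 * Real.sin (√3 / 2 * (radius - x)) ^ 2) : ℝ) : ℂ) x := by
      intro x _
      refine (hF x).comp_ofReal.congr_deriv ?_
      rw [recipDeriv_ofReal]
      push_cast
      rfl
    have h := intervalIntegral.integral_eq_sub_of_hasDerivAt hderiv
      (Continuous.intervalIntegrable (by fun_prop) _ _)
    rw [intervalIntegral.integral_ofReal, Complex.ofReal_zero, hF0, sub_zero] at h
    exact h.symm
  let V : ℂ → ℂ := fun z => (1 + egf z + egf z ^ 2) * F z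
  have hTa := analyticAt_egf
  have hFa : AnalyticAt ℂ F 0 := hFd.analyticAt 0
  have hVa : AnalyticAt ℂ V 0 := by fun_prop
  -- The continuation of `(ρ - z)² V(z)` across `ρ`.
  let g : ℂ → ℂ := fun z => 3 / 4 * F z / sinQuotient z ^ 2
  have hg : DifferentiableOn ℂ g (Metric.ball 0 (2 * radius)) :=
    DifferentiableOn.div (hFd.const_mul _).differentiableOn
      (differentiable_sinQuotient.pow 2).differentiableOn
      fun z hz => pow_ne_zero 2 (sinQuotient_ne_zero hz)
  have hVg : (fun z => (radius - z) ^ 2 * V z) =ᶠ[𝓝 0] g := by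
    filter_upwards [ball_radius_mem_nhds] with z hz
    have hs := sin_angle_ne_zero_of_mem_ball hz
    have h := recipDeriv_mul hs
    rw [recipDeriv, ← sub_mul_sinQuotient] at h
    rw [← sub_mul_sinQuotient] at hs
    have h2 := right_ne_zero_of_mul hs
    simp only [g, V]
    field_simp
    linear_combination 3 * F z * h
  have h := tendsto_taylorCoeffZero_of_double_pole radius_pos radius_lt_two_mul hVa hg hVg
  have hg1 : g radius = sizeIntegral i := by
    simp only [g, sinQuotient_radius, hFint, neg_sq, half_sqrt_three_sq]
    ring
  rw [hg1] at h
  have h' := h.const_mul (((trees (i + 1)).filter P).card / i ! : ℂ)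
  rw [← tendsto_ofReal_iff]
  push_cast
  refine h'.congr fun n => ?_
  rw [vertexCount_eq_iteratedDeriv hP hsize hF hF0, taylorCoeffZero]
  ring

theorem vertexProb_eq (P : OneTwoTree → Prop) [DecidablePred P] (n : ℕ) :
    vertexProb n P = vertexCount P n / (n * (trees n).card : ℝ) := by
  have h : ∑ T ∈ trees n, T.size = (trees n).card * n := by
    rw [Finset.sum_congr rfl fun T hT => size_of_mem_trees hT, Finset.sum_const, smul_eq_mul]
  rw [vertexProb, h, vertexCount]
  push_cast
  ring

theorem tendsto_vertexProb {P : OneTwoTree → Prop} [DecidablePred P]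
    (hP : ∀ f T, P (relabel f T) ↔ P T) {i : ℕ} (hsize : ∀ T, P T → T.size = i + 1) :
    Tendsto (fun n : ℕ => vertexProb n P) atTop
      (𝓝 (((trees (i + 1)).filter P).card / i ! * sizeIntegral i / radius)) := by
  have h := (vertexCount_asymptotics hP hsize).div
    (tendsto_card_trees.const_mul radius) (by simpa using radius_pos.ne')
  rw [mul_one] at h
  refine h.congr fun n => ?_
  have h1 := radius_pos.ne'
  have h2 : (n ! : ℝ) ≠ 0 := by exact_mod_cast n.factorial_ne_zero
  rw [vertexProb_eq, Pi.div_apply]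
  field_simp
  ring

/-! ### The limiting sizes have total mass one -/

/-- The Taylor series of `T'`, multiplied by `1 / T'`. -/
theorem hasSum_deriv_egf_mul_recipDeriv {x : ℝ} (hx : x ∈ Set.Ico 0 radius) :
    HasSum (fun i : ℕ => ((trees (i + 1)).card / i ! : ℝ) *
      (x ^ i * (4 / 3 * Real.sin (√3 / 2 * (radius - x)) ^ 2))) 1 := by
  have hx' : (x : ℂ) ∈ Metric.ball (0 : ℂ) radius := by
    simpa [abs_of_nonneg hx.1] using hx.2
  have hs := sin_angle_ne_zero_of_mem_ball hx'
  have h := (Complex.hasSum_taylorSeries_on_ball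
    (differentiableOn_egf.deriv Metric.isOpen_ball) hx').mul_left (recipDeriv x)
  rw [(hasDerivAt_egf hs).deriv, recipDeriv_mul hs] at h
  rw [← Complex.hasSum_ofReal]
  simp only [recipDeriv_ofReal, sub_zero, ← iteratedDeriv_succ', iteratedDeriv_egf,
    smul_eq_mul] at h
  push_cast at h ⊢
  refine h.congr_fun fun i => ?_
  ring

/-- Integrating `∑ᵢ tᵢ₊₁ xⁱ / i! · 1 / T'(x) = 1` over `[0, ρ]`. -/
theorem hasSum_sizeIntegral :
    HasSum (fun i : ℕ => ((trees (i + 1)).card / i ! : ℝ) * sizeIntegral i / radius) 1 := by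
  let f : ℕ → ℝ → ℝ := fun i x => ((trees (i + 1)).card / i ! : ℝ) *
      (x ^ i * (4 / 3 * Real.sin (√3 / 2 * (radius - x)) ^ 2))
  have hae : ∀ᵐ x : ℝ, x ∈ Set.uIoc 0 radius → HasSum (fun i => f i x) 1 ∧ ∀ i, 0 ≤ f i x := by
    -- The Taylor series need not converge at the right endpoint, a null set.
    have hne : ∀ᵐ x : ℝ, x ≠ radius := by simp [MeasureTheory.ae_iff]
    filter_upwards [hne] with x hx hx'
    rw [Set.uIoc_of_le radius_pos.le] at hx'
    refine ⟨hasSum_deriv_egf_mul_recipDeriv ⟨hx'.1.le, lt_of_le_of_ne hx'.2 hx⟩, fun i => ?_⟩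
    have := hx'.1.le
    positivity
  have h : HasSum (fun i => ∫ x in (0 : ℝ)..radius, f i x) (∫ _ in (0 : ℝ)..radius, (1 : ℝ)) := by
    refine intervalIntegral.hasSum_integral_of_dominated_convergence f
      (fun i => Continuous.aestronglyMeasurable (by fun_prop)) (fun i => ?_) ?_ ?_ ?_
    · filter_upwards [hae] with x hx hx'
      rw [Real.norm_of_nonneg ((hx hx').2 i)]
    · filter_upwards [hae] with x hx hx'
      exact (hx hx').1.summable
    · refine (intervalIntegrable_const (c := (1 : ℝ))).congr_uIoo fun x hx => ?_
      rw [Set.uIoo_of_le radius_pos.le] at hx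
      exact (hasSum_deriv_egf_mul_recipDeriv ⟨hx.1.le, hx.2⟩).tsum_eq.symm
    · filter_upwards [hae] with x hx hx'
      exact (hx hx').1
  have h' := h.div_const radius
  simp only [f, intervalIntegral.integral_const_mul, intervalIntegral.integral_const, sub_zero,
    smul_eq_mul, mul_one, div_self radius_pos.ne'] at h'
  exact h'

end OneTwoTree

/-! ### Passing to the limit in the sum over sizes -/

/-- If `W ≤ U` are non-negative, both converge termwise, and no mass of `U` escapes in the limit,
then the sums of `W` converge to the sum of the termwise limits. -/
theorem summable_and_tendsto_of_le_of_hasSum_one {W U : ℕ → ℕ → ℝ} {w u a : ℕ → ℝ}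
    (hW0 : ∀ n i, 0 ≤ W n i) (hWU : ∀ n i, W n i ≤ U n i)
    (hw : ∀ i, Tendsto (fun n => W n i) atTop (𝓝 (w i)))
    (hu : ∀ i, Tendsto (fun n => U n i) atTop (𝓝 (u i)))
    (hWa : ∀ n, HasSum (W n) (a n)) (hU1 : ∀ᶠ n in atTop, HasSum (U n) 1) (hu1 : HasSum u 1) :
    Summable w ∧ Tendsto a atTop (𝓝 (∑' i, w i)) := by
  have hw0 : ∀ i, 0 ≤ w i := fun i => ge_of_tendsto' (hw i) fun n => hW0 n i
  have hwu : ∀ i, w i ≤ u i := fun i => le_of_tendsto_of_tendsto' (hw i) (hu i) fun n => hWU n i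
  have hws : Summable w := hu1.summable.of_nonneg_of_le hw0 hwu
  refine ⟨hws, Metric.tendsto_atTop'.2 fun ε hε => ?_⟩
  -- The tail of `W n` beyond `M` is at most that of `U n`, which is less than `ε / 3` eventually.
  have hε3 : 0 < ε / 3 := by linarith
  obtain ⟨M, hM1, hM2⟩ := ((hu1.tendsto_sum_nat.eventually_const_lt
    (show 1 - ε / 3 < 1 by linarith)).and (hws.hasSum.tendsto_sum_nat.eventually_const_lt
    (show ∑' i, w i - ε / 3 < ∑' i, w i by linarith))).exists
  have hM3 : ∑ i ∈ Finset.range M, w i ≤ ∑' i, w i := hws.sum_le_tsum _ fun i _ => hw0 i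
  have hWM := tendsto_finsetSum (Finset.range M) fun i _ => hw i
  have hUM := tendsto_finsetSum (Finset.range M) fun i _ => hu i
  have hev := ((hWM.eventually_const_lt
    (show ∑ i ∈ Finset.range M, w i - ε / 3 < _ by linarith)).and (hWM.eventually_lt_const
    (show _ < ∑ i ∈ Finset.range M, w i + ε / 3 by linarith))).and
    ((hUM.eventually_const_lt hM1).and hU1)
  obtain ⟨N, hN⟩ := eventually_atTop.1 hev
  refine ⟨N, fun n hn => ?_⟩
  obtain ⟨⟨h1, h2⟩, h3, h4⟩ := hN n hn.le
  have h5 : ∑ i ∈ Finset.range M, W n i ≤ a n := sum_le_hasSum _ (fun i _ => hW0 n i) (hWa n)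
  have h6 : ∑ i ∈ Finset.range M, (U n i - W n i) ≤ 1 - a n :=
    sum_le_hasSum _ (fun i _ => sub_nonneg.2 (hWU n i)) (h4.sub (hWa n))
  rw [Finset.sum_sub_distrib] at h6
  rw [Real.dist_eq, abs_lt]
  constructor <;> linarith

namespace OneTwoTree

theorem size_le_of_mem_subtrees {s t : OneTwoTree} (h : s ∈ t.subtrees) : s.size ≤ t.size := by
  induction t with
  | leaf a =>
    rw [subtrees, List.mem_singleton] at h
    rw [h]
  | unary a t ih =>
    rw [subtrees, List.mem_cons] at h
    rcases h with rfl | h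
    · rfl
    · have := ih h
      simp only [size, subtrees, List.length_cons] at this ⊢
      omega
  | binary a l r ihl ihr =>
    rw [subtrees, List.mem_cons, List.mem_append] at h
    rcases h with rfl | h | h
    · rfl
    · have := ihl h
      simp only [size, subtrees, List.length_cons, List.length_append] at this ⊢
      omega
    · have := ihr h
      simp only [size, subtrees, List.length_cons, List.length_append] at this ⊢
      omega

theorem sum_countP_and_size_eq (Q : OneTwoTree → Prop) [DecidablePred Q] {n : ℕ}
    (L : List OneTwoTree) (hL : ∀ s ∈ L, s.size ≤ n) :
    ∑ i ∈ Finset.range n, L.countP (fun s => decide (Q s ∧ s.size = i + 1)) =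
      L.countP (fun s => decide (Q s)) := by
  induction L with
  | nil => simp
  | cons s L ih =>
    simp only [List.mem_cons, forall_eq_or_imp] at hL
    simp only [List.countP_cons, Finset.sum_add_distrib, ih hL.2, decide_eq_true_eq]
    congr 1
    have hs := s.size_pos
    rw [Finset.sum_eq_single (s.size - 1)]
    · rw [Nat.sub_add_cancel hs]
      simp
    · intro i _ hi
      rw [if_neg]
      rintro ⟨-, h⟩
      omega
    · intro h
      rw [Finset.mem_range] at h
      omega

theorem hasSum_vertexProb_and_size (Q : OneTwoTree → Prop) [DecidablePred Q] (n : ℕ) :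
    HasSum (fun i => vertexProb n fun s => Q s ∧ s.size = i + 1) (vertexProb n Q) := by
  have hle : ∀ T ∈ trees n, ∀ s ∈ T.subtrees, s.size ≤ n := fun T hT s hs =>
    (size_le_of_mem_subtrees hs).trans (size_of_mem_trees hT).le
  have hsum : vertexProb n Q =
      ∑ i ∈ Finset.range n, vertexProb n fun s => Q s ∧ s.size = i + 1 := by
    simp only [vertexProb]
    rw [← Finset.sum_div, ← Nat.cast_sum, Finset.sum_comm]
    congr 2
    exact Finset.sum_congr rfl fun T hT => (sum_countP_and_size_eq Q _ (hle T hT)).symm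
  rw [hsum]
  refine hasSum_sum_of_ne_finset_zero fun i hi => ?_
  rw [vertexProb, Finset.sum_eq_zero, Nat.cast_zero, zero_div]
  intro T hT
  rw [List.countP_eq_zero]
  intro s hs h
  have h1 := hle T hT s hs
  have h2 := (of_decide_eq_true h).2
  rw [Finset.mem_range] at hi
  omega

theorem card_trees_pos (n : ℕ) : 0 < (trees (n + 1)).card := by
  induction n with
  | zero =>
    rw [card_trees_succ, if_pos rfl]
    omega
  | succ n ih =>
    rw [card_trees_succ]
    omega

theorem vertexProb_true {n : ℕ} (hn : 1 ≤ n) : vertexProb n (fun _ => True) = 1 := by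
  obtain ⟨n, rfl⟩ := Nat.exists_eq_add_of_le' hn
  have h : 0 < ∑ T ∈ trees (n + 1), T.size :=
    Finset.sum_pos (fun T _ => T.size_pos) (Finset.card_pos.1 (card_trees_pos n))
  have h' : ((∑ T ∈ trees (n + 1), T.size : ℕ) : ℝ) ≠ 0 := by exact_mod_cast h.ne'
  rw [vertexProb]
  simp only [decide_true, List.countP_true]
  exact div_self h'

theorem vertexProb_nonneg (P : OneTwoTree → Prop) [DecidablePred P] (n : ℕ) :
    0 ≤ vertexProb n P := by
  unfold vertexProb
  positivity

theorem vertexProb_mono {P Q : OneTwoTree → Prop} [DecidablePred P] [DecidablePred Q]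
    (h : ∀ T, P T → Q T) (n : ℕ) : vertexProb n P ≤ vertexProb n Q := by
  refine div_le_div_of_nonneg_right (Nat.cast_le.2 (Finset.sum_le_sum fun T _ => ?_))
    (Nat.cast_nonneg _)
  exact List.countP_mono_left fun s _ hs => by simpa using h s (by simpa using hs)

end OneTwoTree

theorem mainTheorem2 (k : ℕ) :
    ∃ (w : ℕ → ℝ) (a : ℝ),
      (∀ i : ℕ, 1 ≤ i →
        Tendsto (fun n : ℕ => OneTwoTree.rankSizeProb n k i) atTop (𝓝 (w i))) ∧
      HasSum (fun i : ℕ => w (i + 1)) a ∧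
      Tendsto (fun n : ℕ => OneTwoTree.rankProb n k) atTop (𝓝 a) := by
  classical
  -- `w i` is the limit for subtrees of size `i + 1`.
  let w : ℕ → ℝ := fun i =>
    ((OneTwoTree.trees (i + 1)).filter fun s => s.rank = k ∧ s.size = i + 1).card / i ! *
      OneTwoTree.sizeIntegral i / OneTwoTree.radius
  have hw : ∀ i, Tendsto (fun n => OneTwoTree.rankSizeProb n k (i + 1)) atTop (𝓝 (w i)) :=
    fun i => OneTwoTree.tendsto_vertexProb
      (fun f T => by rw [OneTwoTree.rank_relabel, OneTwoTree.size_relabel]) fun T hT => hT.2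
  have hu : ∀ i, Tendsto (fun n => OneTwoTree.vertexProb n fun s => True ∧ s.size = i + 1) atTop
      (𝓝 (((OneTwoTree.trees (i + 1)).card / i ! : ℝ) * OneTwoTree.sizeIntegral i /
        OneTwoTree.radius)) := by
    intro i
    have h := OneTwoTree.tendsto_vertexProb (P := fun s => True ∧ s.size = i + 1) (i := i)
      (fun f T => by rw [OneTwoTree.size_relabel]) fun T hT => hT.2
    rwa [Finset.filter_true_of_mem fun T hT => ⟨trivial, OneTwoTree.size_of_mem_trees hT⟩] at h
  obtain ⟨hs, ha⟩ := summable_and_tendsto_of_le_of_hasSum_one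
    (fun n i => OneTwoTree.vertexProb_nonneg _ n)
    (fun n i => OneTwoTree.vertexProb_mono (fun T hT => ⟨trivial, hT.2⟩) n) hw hu
    (fun n => OneTwoTree.hasSum_vertexProb_and_size (fun s => s.rank = k) n)
    (eventually_atTop.2 ⟨1, fun n hn =>
      OneTwoTree.vertexProb_true hn ▸ OneTwoTree.hasSum_vertexProb_and_size _ n⟩)
    OneTwoTree.hasSum_sizeIntegral
  refine ⟨fun i => w (i - 1), ∑' i, w i, fun i hi => ?_, hs.hasSum, ha⟩
  obtain ⟨i, rfl⟩ := Nat.exists_eq_add_of_le' hi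
  exact hw i
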